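/- Let $-\infty<a<b<\infty$. For $\alpha>0$ and a continuous $g$ on $[a,b]$ put $J_a^\alpha g(t)=\frac1{\Gamma(\alpha)}\int_a^t(t-s)^{\alpha-1}g(s)\,ds$, and $J_a^0g=g$. For $\alpha>0$ and $m=\lceil\alpha\rceil$, a function $x\in C^{m-1}[a,b]$ is called continuously Caputo $\alpha$-differentiable if ${}^{C}\!D_a^\alpha x:=D^mJ_a^{m-\alpha}(x-T_{m-1}[x;a])$ exists and is continuous on $[a,b]$, where $T_{m-1}[x;a](t)=\sum_{i=0}^{m-1}\frac{(D^ix)(a)}{i!}(t-a)^i$; put ${}^{C}\!D_a^0x=x$ (continuously Caputo $0$-differentiable means continuous). Let $k\ge1$ and let $0=\alpha_0<\alpha_1<\dots<\alpha_k$ be rational numbers with $\alpha_j-\alpha_{j-1}\le1$ for $j=1,\dots,k$. Let $M$ be the least common multiple of the denominators of $\alpha_1,\dots,\alpha_k$, $\gamma=1/M$ and $N=M\alpha_k$. Let $f:[a,b]\times\mathbb{R}^k\to\mathbb{R}$ be continuous, and assume that there is $L>0$ with $|f(t,y)-f(t,z)|\le L\|y-z\|$ for all $t\in[a,b]$ and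 $y,z\in\mathbb{R}^k$. Let $x_a^{(0)},\dots,x_a^{(\lceil\alpha_k\rceil-1)}$ be real numbers. Consider (A) the multi-term problem $${}^{C}\!D_a^{\alpha_k}x(t)=f\bigl(t,x(t),{}^{C}\!D_a^{\alpha_1}x(t),\dots,{}^{C}\!D_a^{\alpha_{k-1}}x(t)\bigr)\quad(t\in[a,b]),\qquad (D^jx)(a)=x_a^{(j)}\quad(0\le j\le\lceil\alpha_k\rceil-1),$$ whose solutions are the continuously Caputo $\alpha_k$-differentiable functions $x$ on $[a,b]$ that satisfy it, and (B) the single-term system of order $\gamma$ on $[a,b]$ $${}^{C}\!D_a^{\gamma}x_j(t)=x_{j+1}(t)\quad(0\le j\le N-2),\qquad {}^{C}\!D_a^{\gamma}x_{N-1}(t)=f\bigl(t,x_0(t),x_{\alpha_1/\gamma}(t),\dots,x_{\alpha_{k-1}/\gamma}(t)\bigr),$$ with $x_j(a)=x_a^{(j/M)}$ if $j/M$ is an integer and $x_j(a)=0$ otherwise $(0\le j\le N-1)$, whose solutions are the vector functions $(x_0,\dots,x_{N-1})$ with continuously Caputo $\gamma$-differentiable components that satisfy it. Then (A) has a unique solution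 on $[a,b]$, and (B) has a unique solution on $[a,b]$. Moreover, if $(x_0,\dots,x_{N-1})$ solves (B), then $x_0$ solves (A); and if $x$ solves (A), then $x$ is continuously Caputo $j\gamma$-differentiable for $0\le j\le N$, and $(x,{}^{C}\!D_a^{\gamma}x,{}^{C}\!D_a^{2\gamma}x,\dots,{}^{C}\!D_a^{(N-1)\gamma}x)$ solves (B). -/

import Mathlib

open Set

noncomputable section

namespace Caputo

/-- The Riemann-Liouville fractional integral `J_a^α f`, with `J_a^0 = I`. -/
def rlIntegral (a α : ℝ) (f : ℝ → ℝ) (x : ℝ) : ℝ :=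
  if α = 0 then f x
  else 1 / Real.Gamma α * ∫ t in a..x, (x - t) ^ (α - 1) * f t

/-- The Riemann-Liouville derivative `D^m J_a^{m-α} f` on `[a,b]`, `m = ⌈α⌉` (identity for `α = 0`).
Integer-order derivatives are taken relative to `[a,b]`, hence one-sided at the endpoints. -/
def rlDeriv (a b α : ℝ) (f : ℝ → ℝ) (t : ℝ) : ℝ :=
  if α = 0 then f t
  else iteratedDerivWithin ⌈α⌉₊ (rlIntegral a (⌈α⌉₊ - α) f) (Icc a b) t

/-- For `α > 0`: `f` is continuous on `[a,b]`, and `D^m J_a^{m-α} f`, `m = ⌈α⌉`, exists and is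
continuous on `[a,b]`. -/
def ContRLDiff (a b α : ℝ) (f : ℝ → ℝ) : Prop :=
  ContinuousOn f (Icc a b) ∧
    (α ≠ 0 → ContDiffOn ℝ ⌈α⌉₊ (rlIntegral a (⌈α⌉₊ - α) f) (Icc a b))

/-- `f - T_{m-1}[f;a]`, where `m = ⌈α⌉` and `T_{m-1}[f;a]` is the Taylor polynomial of degree
`m - 1` of `f` at `a`; used for `α > 0` only, so that `m ≥ 1`. -/
def subTaylor (a b α : ℝ) (f : ℝ → ℝ) (t : ℝ) : ℝ :=
  f t - taylorWithinEval f (⌈α⌉₊ - 1) (Icc a b) a t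

/-- The Caputo derivative of order `α` on `[a,b]` (identity for `α = 0`). -/
def caputoDeriv (a b α : ℝ) (f : ℝ → ℝ) (t : ℝ) : ℝ :=
  if α = 0 then f t else rlDeriv a b α (subTaylor a b α f) t

/-- `f` is continuously Caputo `α`-differentiable on `[a,b]`: `f ∈ C^{⌈α⌉-1}[a,b]` and its Caputo
derivative of order `α` exists and is continuous on `[a,b]` (for `α = 0`: `f` is continuous). -/
def ContCaputoDiff (a b α : ℝ) (f : ℝ → ℝ) : Prop :=
  if α = 0 then ContinuousOn f (Icc a b)
  else ContDiffOn ℝ (⌈α⌉₊ - 1 : ℕ) f (Icc a b) ∧ ContRLDiff a b α (subTaylor a b α f)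

variable {k : ℕ}

/-- `x` solves `D^{α_k} x(t) = f(t, x(t), D^{α_1} x(t), …, D^{α_{k-1}} x(t))` on `[a,b]`,
`(D^j x)(a) = ξ j` for `j = 0, …, ⌈α_k⌉ - 1`. Here `α 0` stands for `0`, so that the zeroth
state argument of `f` is `x(t)`. -/
structure IsMultiTermSolution (a b : ℝ) (α : Fin (k + 1) → ℚ) (f : ℝ → (Fin k → ℝ) → ℝ)
    (ξ : ℕ → ℝ) (x : ℝ → ℝ) : Prop where
  contDiff : ContCaputoDiff a b (α (Fin.last k)) x
  equation : ∀ t ∈ Icc a b, caputoDeriv a b (α (Fin.last k)) x t =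
    f t (fun i => caputoDeriv a b (α i.castSucc) x t)
  initial : ∀ j < ⌈α (Fin.last k)⌉₊, iteratedDerivWithin j x (Icc a b) a = ξ j

/-- The least common multiple `M` of the denominators of the orders. -/
def lcmDen (α : Fin (k + 1) → ℚ) : ℕ := Finset.univ.lcm fun i => (α i).den

/-- The natural number `M α_i = α_i / γ`. -/
def scaled (α : Fin (k + 1) → ℚ) (i : Fin (k + 1)) : ℕ := ⌊(lcmDen α : ℚ) * α i⌋₊

/-- The dimension `N = M α_k`. -/
def dim (α : Fin (k + 1) → ℚ) : ℕ := scaled α (Fin.last k)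

theorem lcmDen_pos (α : Fin (k + 1) → ℚ) : 0 < lcmDen α := by
  refine Nat.pos_of_ne_zero fun h => ?_
  obtain ⟨i, _, hi⟩ := Finset.lcm_eq_zero_iff.1 h
  exact (α i).den_nz hi

theorem scaled_cast (α : Fin (k + 1) → ℚ) (i : Fin (k + 1)) (hi : 0 ≤ α i) :
    (scaled α i : ℚ) = lcmDen α * α i := by
  obtain ⟨c, hc⟩ : (α i).den ∣ lcmDen α := Finset.dvd_lcm (Finset.mem_univ i)
  have h : (lcmDen α : ℚ) * α i = ((c * (α i).num.toNat : ℕ) : ℚ) := by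
    have hn : (((α i).num.toNat : ℕ) : ℚ) = (α i).num := by
      exact_mod_cast congrArg (Int.cast : ℤ → ℚ) (Int.toNat_of_nonneg (Rat.num_nonneg.2 hi))
    rw [hc]
    push_cast
    rw [hn, mul_comm ((α i).den : ℚ) c, mul_assoc, Rat.den_mul_eq_num]
  rw [scaled, h, Nat.floor_natCast]

theorem scaled_lt (α : Fin (k + 1) → ℚ) (h0 : α 0 = 0) (hα : StrictMono α) (i : Fin k) :
    scaled α i.castSucc < dim α := by
  have hnn : ∀ j, 0 ≤ α j := fun j => h0 ▸ hα.monotone (Fin.zero_le j)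
  have hM : (0 : ℚ) < lcmDen α := by exact_mod_cast lcmDen_pos α
  have h : (scaled α i.castSucc : ℚ) < (dim α : ℚ) := by
    rw [dim, scaled_cast α _ (hnn _), scaled_cast α _ (hnn _)]
    exact mul_lt_mul_of_pos_left (hα (Fin.castSucc_lt_last i)) hM
  exact_mod_cast h

theorem dim_pos (α : Fin (k + 1) → ℚ) (h0 : α 0 = 0) (hα : StrictMono α) (hk : 0 < k) :
    0 < dim α :=
  (Nat.zero_le _).trans_lt (scaled_lt α h0 hα ⟨0, hk⟩)

/-- The index `α_i / γ` of a component of the reduced system. -/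
def termIndex (α : Fin (k + 1) → ℚ) (h0 : α 0 = 0) (hα : StrictMono α) (i : Fin k) :
    Fin (dim α) :=
  ⟨scaled α i.castSucc, scaled_lt α h0 hα i⟩

/-- `X = (x_0, …, x_{N-1})` solves on `[a,b]` the single-term system of order `γ = 1/M`
`D^γ x_j = x_{j+1}` for `j < N - 1`, `D^γ x_{N-1} = f(t, x_0, x_{α_1/γ}, …, x_{α_{k-1}/γ})`,
with `x_j(a) = ξ (j/M)` if `M ∣ j` and `x_j(a) = 0` otherwise. -/
structure IsReducedSolution (a b : ℝ) (α : Fin (k + 1) → ℚ) (h0 : α 0 = 0) (hα : StrictMono α)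
    (f : ℝ → (Fin k → ℝ) → ℝ) (ξ : ℕ → ℝ) (X : Fin (dim α) → ℝ → ℝ) : Prop where
  contDiff : ∀ j, ContCaputoDiff a b (1 / lcmDen α) (X j)
  chain : ∀ i j : Fin (dim α), (i : ℕ) + 1 = j → ∀ t ∈ Icc a b,
    caputoDeriv a b (1 / lcmDen α) (X i) t = X j t
  equation : ∀ j : Fin (dim α), (j : ℕ) + 1 = dim α → ∀ t ∈ Icc a b,
    caputoDeriv a b (1 / lcmDen α) (X j) t = f t (fun i => X (termIndex α h0 hα i) t)
  initial : ∀ j : Fin (dim α), X j a = if lcmDen α ∣ (j : ℕ) then ξ (j / lcmDen α) else 0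

end Caputo

end

/-!
A solution `x` of the multi-term problem and a solution `(x_0, …, x_{N-1})` of the system are both
determined by the highest derivative `g = D^{α_k} x`, that is `g = D^γ x_{N-1}`. A Caputo equation
`D^α x = g` with initial data amounts to the Taylor expansion of `x` with remainder `J_a^α g`, so
the system says `x_j = x_j(a) + J_a^γ x_{j+1}` with `x_N = g`. By the semigroup law
`J_a^α J_a^β = J_a^{α+β}` these relations compose to the expansion of `x_j` with remainder
`J_a^{(N-j)γ} g`, and for `j = 0` the initial values vanishing off the integer orders turn it into
the Taylor expansion that characterises `D^{α_k} x_0 = g`. Both problems are therefore equivalent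
to one Volterra equation `g(t) = f(t, …)` with arguments `p_i(t) + J_a^{β_i} g(t)`, `β_i > 0`. Its
right side is a contraction for the sup norm weighted by `exp (-λ (t - a))` with `λ` large, because
`J_a^β exp (λ (· - a)) ≤ λ^{-β} exp (λ (· - a))`.

The semigroup law and the continuity of `J_a^α g` hold for powers of `t - a` by the Beta integral
and pass to all continuous functions by Weierstrass approximation.
-/

open Set Filter MeasureTheory
open scoped NNReal

noncomputable section

namespace Caputo

section RiemannLiouville

variable {a b α x : ℝ} {f g : ℝ → ℝ}

theorem rlIntegral_zero (a : ℝ) (f : ℝ → ℝ) : rlIntegral a 0 f = f :=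
  funext fun _ => if_pos rfl

theorem rlIntegral_of_ne_zero (a : ℝ) (hα : α ≠ 0) (f : ℝ → ℝ) (x : ℝ) :
    rlIntegral a α f x = 1 / Real.Gamma α * ∫ t in a..x, (x - t) ^ (α - 1) * f t :=
  if_neg hα

theorem rlIntegral_one (a : ℝ) (f : ℝ → ℝ) (x : ℝ) : rlIntegral a 1 f x = ∫ t in a..x, f t := by
  simp [rlIntegral]

theorem rlIntegral_apply_left (h : α ≠ 0 ∨ f a = 0) : rlIntegral a α f a = 0 := by
  rcases eq_or_ne α 0 with rfl | hα
  · simpa [rlIntegral_zero] using h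
  · simp [rlIntegral_of_ne_zero a hα]

theorem rlIntegral_congr (α : ℝ) (h : EqOn f g (Icc a b)) :
    EqOn (rlIntegral a α f) (rlIntegral a α g) (Icc a b) := by
  intro x hx
  unfold rlIntegral
  split_ifs
  · exact h hx
  · congr 1
    refine intervalIntegral.integral_congr fun t ht => ?_
    rw [uIcc_of_le hx.1] at ht
    simp only [h ⟨ht.1, ht.2.trans hx.2⟩]

theorem intervalIntegrable_kernel_mul (hα : 0 < α) (hx : x ∈ Icc a b)
    (hf : ContinuousOn f (Icc a b)) :
    IntervalIntegrable (fun t => (x - t) ^ (α - 1) * f t) volume a x := by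
  have hkernel : IntervalIntegrable (fun t => (x - t) ^ (α - 1)) volume a x := by
    simpa using (intervalIntegral.intervalIntegrable_rpow' (a := x - a) (b := 0)
      (r := α - 1) (by linarith)).comp_sub_left x
  refine hkernel.mul_continuousOn (hf.mono ?_)
  rw [uIcc_of_le hx.1]
  exact Icc_subset_Icc_right hx.2

theorem rlIntegral_const_mul (a α c : ℝ) (f : ℝ → ℝ) (x : ℝ) :
    rlIntegral a α (fun t => c * f t) x = c * rlIntegral a α f x := by
  unfold rlIntegral
  split_ifs
  · rfl
  · simp only [mul_left_comm _ c, intervalIntegral.integral_const_mul]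

theorem rlIntegral_sum (hα : 0 ≤ α) (hx : x ∈ Icc a b) {ι : Type*} (s : Finset ι)
    {f : ι → ℝ → ℝ} (hf : ∀ i ∈ s, ContinuousOn (f i) (Icc a b)) :
    rlIntegral a α (fun t => ∑ i ∈ s, f i t) x = ∑ i ∈ s, rlIntegral a α (f i) x := by
  rcases hα.eq_or_lt with rfl | hα
  · simp only [rlIntegral_zero]
  · simp only [rlIntegral_of_ne_zero a hα.ne', Finset.mul_sum]
    rw [intervalIntegral.integral_finsetSum fun i hi =>
      intervalIntegrable_kernel_mul hα hx (hf i hi), Finset.mul_sum]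

theorem rlIntegral_add (hα : 0 ≤ α) (hx : x ∈ Icc a b) (hf : ContinuousOn f (Icc a b))
    (hg : ContinuousOn g (Icc a b)) :
    rlIntegral a α (fun t => f t + g t) x = rlIntegral a α f x + rlIntegral a α g x := by
  simpa using rlIntegral_sum hα hx Finset.univ (f := ![f, g]) (by simp [hf, hg])

theorem rlIntegral_sub (hα : 0 ≤ α) (hx : x ∈ Icc a b) (hf : ContinuousOn f (Icc a b))
    (hg : ContinuousOn g (Icc a b)) :
    rlIntegral a α (fun t => f t - g t) x = rlIntegral a α f x - rlIntegral a α g x := by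
  have h := rlIntegral_add hα hx hf (g := fun t => -1 * g t) (continuousOn_const.mul hg)
  rw [rlIntegral_const_mul] at h
  simpa [sub_eq_add_neg] using h

theorem rlIntegral_mono (hα : 0 ≤ α) (hx : x ∈ Icc a b) (hf : ContinuousOn f (Icc a b))
    (hg : ContinuousOn g (Icc a b)) (h : ∀ t ∈ Icc a b, f t ≤ g t) :
    rlIntegral a α f x ≤ rlIntegral a α g x := by
  rcases hα.eq_or_lt with rfl | hα
  · simpa [rlIntegral_zero] using h x hx
  · simp only [rlIntegral_of_ne_zero a hα.ne']
    have := Real.Gamma_pos_of_pos hα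
    gcongr
    refine intervalIntegral.integral_mono_on hx.1 (intervalIntegrable_kernel_mul hα hx hf)
      (intervalIntegrable_kernel_mul hα hx hg) fun t ht => ?_
    exact mul_le_mul_of_nonneg_left (h t ⟨ht.1, ht.2.trans hx.2⟩)
      (Real.rpow_nonneg (sub_nonneg.2 ht.2) _)

theorem abs_rlIntegral_le (hα : 0 ≤ α) (hx : x ∈ Icc a b) (hf : ContinuousOn f (Icc a b))
    (hg : ContinuousOn g (Icc a b)) (h : ∀ t ∈ Icc a b, |f t| ≤ g t) :
    |rlIntegral a α f x| ≤ rlIntegral a α g x := by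
  have hlower := rlIntegral_mono hα hx (f := fun t => -1 * g t) (continuousOn_const.mul hg) hf
    fun t ht => by linarith [(abs_le.1 (h t ht)).1]
  rw [rlIntegral_const_mul, neg_one_mul] at hlower
  exact abs_le.2 ⟨hlower, rlIntegral_mono hα hx hf hg fun t ht => (abs_le.1 (h t ht)).2⟩

end RiemannLiouville

section Powers

variable {a b α ν x : ℝ} {f : ℝ → ℝ}

theorem integral_sub_rpow_mul_rpow {y u v : ℝ} (hy : 0 < y) (hu : 0 < u) (hv : 0 < v) :
    ∫ s in (0 : ℝ)..y, (y - s) ^ (v - 1) * s ^ (u - 1) =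
      Real.Gamma u * Real.Gamma v / Real.Gamma (u + v) * y ^ (u + v - 1) := by
  have h := Complex.betaIntegral_scaled u v hy
  rw [Complex.betaIntegral_eq_Gamma_mul_div _ _ (by simpa) (by simpa), ← Complex.ofReal_add,
    Complex.Gamma_ofReal, Complex.Gamma_ofReal, Complex.Gamma_ofReal] at h
  rw [← Complex.ofReal_inj, ← intervalIntegral.integral_ofReal]
  refine (intervalIntegral.integral_congr fun s hs => ?_).trans (h.trans ?_)
  · rw [uIcc_of_le hy.le] at hs
    have hys : 0 ≤ y - s := sub_nonneg.2 hs.2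
    simp only [Complex.ofReal_mul, Complex.ofReal_cpow hys, Complex.ofReal_cpow hs.1]
    push_cast
    ring
  · push_cast [Complex.ofReal_cpow hy.le]
    ring

theorem rlIntegral_rpow (hα : 0 ≤ α) (hν : 0 ≤ ν) (hx : a ≤ x) :
    rlIntegral a α (fun t => (t - a) ^ ν) x =
      Real.Gamma (ν + 1) / Real.Gamma (ν + α + 1) * (x - a) ^ (ν + α) := by
  have hΓν : 0 < Real.Gamma (ν + 1) := Real.Gamma_pos_of_pos (by linarith)
  rcases hα.eq_or_lt with rfl | hα
  · simp [rlIntegral_zero, hΓν.ne']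
  rcases hx.eq_or_lt with rfl | hx
  · rw [rlIntegral_apply_left (.inl hα.ne'), sub_self, Real.zero_rpow (by linarith), mul_zero]
  have : 0 < Real.Gamma α := Real.Gamma_pos_of_pos hα
  have hbeta := integral_sub_rpow_mul_rpow (sub_pos.2 hx) (u := ν + 1) (by linarith) hα
  have hshift := intervalIntegral.integral_comp_sub_right (a := a) (b := x)
    (fun s => (x - a - s) ^ (α - 1) * s ^ (ν + 1 - 1)) a
  simp only [sub_sub_sub_cancel_right, sub_self] at hshift
  rw [add_sub_cancel_right] at hbeta hshift
  rw [rlIntegral_of_ne_zero a hα.ne', hshift, hbeta, show ν + 1 + α - 1 = ν + α by ring,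
    show ν + 1 + α = ν + α + 1 by ring]
  field_simp

/-- The power `(t - a)^ν / Γ(ν + 1)`, normalised so that `J_a^α` shifts the exponent by `α`. -/
def gammaPow (a ν t : ℝ) : ℝ := (t - a) ^ ν / Real.Gamma (ν + 1)

theorem gammaPow_zero (a t : ℝ) : gammaPow a 0 t = 1 := by simp [gammaPow]

theorem gammaPow_natCast (a : ℝ) (n : ℕ) (t : ℝ) :
    gammaPow a n t = (t - a) ^ n / n.factorial := by
  simp [gammaPow, Real.Gamma_nat_eq_factorial]

theorem gammaPow_apply_left (a : ℝ) (hν : 0 < ν) : gammaPow a ν a = 0 := by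
  simp [gammaPow, Real.zero_rpow hν.ne']

theorem continuous_gammaPow (a : ℝ) (hν : 0 ≤ ν) : Continuous (gammaPow a ν) := by
  unfold gammaPow
  exact ((continuous_id.sub continuous_const).rpow_const fun _ => Or.inr hν).div_const _

theorem gammaPow_le_gammaPow (hν : 0 ≤ ν) (hx : x ∈ Icc a b) :
    gammaPow a ν x ≤ gammaPow a ν b := by
  have : 0 < Real.Gamma (ν + 1) := Real.Gamma_pos_of_pos (by linarith)
  have := sub_nonneg.2 hx.1
  unfold gammaPow
  gcongr
  exact hx.2

theorem rlIntegral_gammaPow (hα : 0 ≤ α) (hν : 0 ≤ ν) (hx : a ≤ x) :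
    rlIntegral a α (gammaPow a ν) x = gammaPow a (ν + α) x := by
  have : 0 < Real.Gamma (ν + 1) := Real.Gamma_pos_of_pos (by linarith)
  have hdef : gammaPow a ν = fun t => (Real.Gamma (ν + 1))⁻¹ * (t - a) ^ ν :=
    funext fun t => div_eq_inv_mul _ _
  rw [hdef, rlIntegral_const_mul, rlIntegral_rpow hα hν hx, gammaPow]
  field_simp

theorem abs_rlIntegral_le_mul_gammaPow (hα : 0 ≤ α) (hx : x ∈ Icc a b)
    (hf : ContinuousOn f (Icc a b)) {B : ℝ} (hB : ∀ t ∈ Icc a b, |f t| ≤ B) :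
    |rlIntegral a α f x| ≤ B * gammaPow a α x := by
  have h := abs_rlIntegral_le hα hx hf (g := fun t => B * gammaPow a 0 t)
    (continuous_const.mul (continuous_gammaPow a le_rfl)).continuousOn
    (by simpa only [gammaPow_zero, mul_one] using hB)
  rwa [rlIntegral_const_mul, rlIntegral_gammaPow hα le_rfl hx.1, zero_add] at h

/-- The generalised polynomial with coefficients `c i` and exponents `ν i`, `i < n`, in the basis of
the normalised powers. -/
def gammaSum (a : ℝ) (n : ℕ) (c ν : ℕ → ℝ) (t : ℝ) : ℝ :=
  ∑ i ∈ Finset.range n, c i * gammaPow a (ν i) t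

variable {n : ℕ} {c e : ℕ → ℝ}

theorem continuous_gammaSum (a : ℝ) (n : ℕ) (c : ℕ → ℝ) (he : ∀ i, 0 ≤ e i) :
    Continuous (gammaSum a n c e) :=
  continuous_finsetSum _ fun i _ => continuous_const.mul (continuous_gammaPow a (he i))

theorem rlIntegral_gammaSum (hα : 0 ≤ α) (he : ∀ i, 0 ≤ e i) :
    EqOn (rlIntegral a α (gammaSum a n c e)) (gammaSum a n c fun i => e i + α) (Ici a) := by
  intro x hx
  unfold gammaSum
  rw [rlIntegral_sum hα (right_mem_Icc.2 hx) _ fun i _ =>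
    (continuous_const.fun_mul (continuous_gammaPow a (he i))).continuousOn]
  exact Finset.sum_congr rfl fun i _ => by
    rw [rlIntegral_const_mul, rlIntegral_gammaPow hα (he i) hx]

theorem eval_eq_gammaSum (a : ℝ) (p : Polynomial ℝ) (t : ℝ) :
    p.eval t = gammaSum a (p.natDegree + 1)
      (fun i => (Polynomial.taylor a p).coeff i * i.factorial) (fun i => i) t := by
  rw [← sub_add_cancel t a, ← Polynomial.taylor_eval, Polynomial.eval_eq_sum_range,
    Polynomial.natDegree_taylor, sub_add_cancel]
  refine Finset.sum_congr rfl fun i _ => ?_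
  rw [gammaPow_natCast]
  field_simp

theorem exists_tendstoUniformlyOn_gammaSum (hf : ContinuousOn f (Icc a b)) :
    ∃ (n : ℕ → ℕ) (c : ℕ → ℕ → ℝ),
      TendstoUniformlyOn (fun m => gammaSum a (n m) (c m) fun i => i) f atTop (Icc a b) := by
  choose p hp using fun m : ℕ =>
    exists_polynomial_near_of_continuousOn a b f hf (1 / (m + 1)) (by positivity)
  refine ⟨fun m => (p m).natDegree + 1, fun m i => (Polynomial.taylor a (p m)).coeff i *
    i.factorial, Metric.tendstoUniformlyOn_iff.2 fun ε hε => ?_⟩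
  filter_upwards [tendsto_one_div_add_atTop_nhds_zero_nat.eventually_lt_const hε] with m hm t ht
  rw [dist_comm, Real.dist_eq, ← eval_eq_gammaSum a (p m)]
  exact (hp m t ht).trans hm

end Powers

section Semigroup

variable {a b α β : ℝ} {f : ℝ → ℝ}

theorem tendstoUniformlyOn_rlIntegral (hα : 0 ≤ α) {ι : Type*} {l : Filter ι} {F : ι → ℝ → ℝ}
    (hF : ∀ i, ContinuousOn (F i) (Icc a b)) (hf : ContinuousOn f (Icc a b))
    (h : TendstoUniformlyOn F f l (Icc a b)) :
    TendstoUniformlyOn (fun i => rlIntegral a α (F i)) (rlIntegral a α f) l (Icc a b) := by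
  rw [Metric.tendstoUniformlyOn_iff] at h ⊢
  intro ε hε
  have hC : 0 < |gammaPow a α b| + 1 := by positivity
  filter_upwards [h (ε / (|gammaPow a α b| + 1)) (by positivity)] with i hi x hx
  have hle := abs_rlIntegral_le_mul_gammaPow hα hx (hf.fun_sub (hF i)) fun t ht => (hi t ht).le
  rw [rlIntegral_sub hα hx hf (hF i)] at hle
  calc dist (rlIntegral a α f x) (rlIntegral a α (F i) x)
      ≤ ε / (|gammaPow a α b| + 1) * gammaPow a α x := hle
    _ < ε / (|gammaPow a α b| + 1) * (|gammaPow a α b| + 1) := by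
      gcongr
      linarith [gammaPow_le_gammaPow hα hx, le_abs_self (gammaPow a α b)]
    _ = ε := div_mul_cancel₀ ε hC.ne'

theorem continuousOn_rlIntegral (hα : 0 ≤ α) (hf : ContinuousOn f (Icc a b)) :
    ContinuousOn (rlIntegral a α f) (Icc a b) := by
  obtain ⟨n, c, h⟩ := exists_tendstoUniformlyOn_gammaSum hf
  have hcont := fun m => (continuous_gammaSum a (n m) (c m) fun i => i.cast_nonneg).continuousOn
    (s := Icc a b)
  refine (tendstoUniformlyOn_rlIntegral hα hcont hf h).continuousOn
    (Frequently.of_forall fun m => ?_)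
  exact (continuous_gammaSum a (n m) (c m) fun i => by positivity).continuousOn.congr
    ((rlIntegral_gammaSum hα fun i => i.cast_nonneg).mono Icc_subset_Ici_self)

theorem rlIntegral_rlIntegral (hα : 0 ≤ α) (hβ : 0 ≤ β) (hf : ContinuousOn f (Icc a b)) :
    EqOn (rlIntegral a α (rlIntegral a β f)) (rlIntegral a (α + β) f) (Icc a b) := by
  obtain ⟨n, c, h⟩ := exists_tendstoUniformlyOn_gammaSum hf
  have hcont := fun m => (continuous_gammaSum a (n m) (c m) fun i => i.cast_nonneg).continuousOn
    (s := Icc a b)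
  have hαβ := tendstoUniformlyOn_rlIntegral (add_nonneg hα hβ) hcont hf h
  have hiter := tendstoUniformlyOn_rlIntegral hα
    (fun m => continuousOn_rlIntegral hβ (hcont m)) (continuousOn_rlIntegral hβ hf)
    (tendstoUniformlyOn_rlIntegral hβ hcont hf h)
  intro x hx
  refine tendsto_nhds_unique (hiter.tendsto_at hx) ((hαβ.tendsto_at hx).congr fun m => ?_)
  rw [rlIntegral_gammaSum (add_nonneg hα hβ) (fun i => i.cast_nonneg) hx.1,
    rlIntegral_congr α ((rlIntegral_gammaSum hβ fun i => i.cast_nonneg).mono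
      Icc_subset_Ici_self) hx, rlIntegral_gammaSum hα (fun i => by positivity) hx.1]
  simp only [add_assoc, add_comm β α]

end Semigroup

section FracTaylor

variable {a b α β γ : ℝ} {c : ℕ → ℝ} {n : ℕ} {g g' : ℝ → ℝ}

/-- The expansion `∑_{i < n} c_i (t - a)^{iγ} / Γ(iγ + 1) + J_a^β g(t)` of step `γ` with a
fractional integral as remainder; for `γ = 1` and `β = n` it is the classical Taylor expansion. -/
def fracTaylor (a γ β : ℝ) (c : ℕ → ℝ) (n : ℕ) (g : ℝ → ℝ) (t : ℝ) : ℝ :=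
  gammaSum a n c (fun i => i * γ) t + rlIntegral a β g t

theorem fracTaylor_zero (a γ : ℝ) (c : ℕ → ℝ) (g : ℝ → ℝ) : fracTaylor a γ 0 c 0 g = g := by
  ext t
  simp [fracTaylor, gammaSum, rlIntegral_zero]

theorem fracTaylor_zero_coeff (a γ β : ℝ) (n : ℕ) (g : ℝ → ℝ) :
    fracTaylor a γ β (fun _ => 0) n g = rlIntegral a β g := by
  ext t
  simp [fracTaylor, gammaSum]

theorem fracTaylor_one (a γ β : ℝ) (c : ℕ → ℝ) (g : ℝ → ℝ) (t : ℝ) :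
    fracTaylor a γ β c 1 g t = c 0 + rlIntegral a β g t := by
  simp [fracTaylor, gammaSum, gammaPow_zero]

theorem fracTaylor_apply_left (hγ : 0 < γ) (hβ : β ≠ 0) (c : ℕ → ℝ) (hn : 0 < n) (g : ℝ → ℝ) :
    fracTaylor a γ β c n g a = c 0 := by
  obtain ⟨n, rfl⟩ := Nat.exists_eq_add_of_le' hn
  rw [fracTaylor, rlIntegral_apply_left (.inl hβ), gammaSum, Finset.sum_range_succ',
    Finset.sum_eq_zero fun i _ => by rw [gammaPow_apply_left a (by positivity), mul_zero]]
  simp [gammaPow_zero]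

theorem fracTaylor_congr (a γ β : ℝ) {c' : ℕ → ℝ} (hc : ∀ i < n, c i = c' i)
    (hg : EqOn g g' (Icc a b)) :
    EqOn (fracTaylor a γ β c n g) (fracTaylor a γ β c' n g') (Icc a b) := fun t ht =>
  congrArg₂ (· + ·) (Finset.sum_congr rfl fun i hi => by rw [hc i (Finset.mem_range.1 hi)])
    (rlIntegral_congr β hg ht)

theorem continuousOn_fracTaylor (hγ : 0 ≤ γ) (hβ : 0 ≤ β) (c : ℕ → ℝ) (n : ℕ)
    (hg : ContinuousOn g (Icc a b)) : ContinuousOn (fracTaylor a γ β c n g) (Icc a b) :=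
  (continuous_gammaSum a n c fun i => by positivity).continuousOn.add
    (continuousOn_rlIntegral hβ hg)

theorem rlIntegral_fracTaylor (hα : 0 ≤ α) (hγ : 0 ≤ γ) (hβ : 0 ≤ β) (c : ℕ → ℝ) (n : ℕ)
    (hg : ContinuousOn g (Icc a b)) {t : ℝ} (ht : t ∈ Icc a b) :
    rlIntegral a α (fracTaylor a γ β c n g) t =
      gammaSum a n c (fun i => i * γ + α) t + rlIntegral a (α + β) g t := by
  have hν : ∀ i : ℕ, 0 ≤ (i : ℝ) * γ := fun i => by positivity
  unfold fracTaylor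
  rw [rlIntegral_add hα ht (continuous_gammaSum a n c hν).continuousOn
    (continuousOn_rlIntegral hβ hg), rlIntegral_gammaSum hα hν ht.1,
    rlIntegral_rlIntegral hα hβ hg ht]

theorem fracTaylor_fracTaylor (hγ : 0 ≤ γ) (hβ : 0 ≤ β) (c : ℕ → ℝ) (m n : ℕ)
    (hg : ContinuousOn g (Icc a b)) :
    EqOn (fracTaylor a γ (m * γ) c m (fracTaylor a γ β (fun l => c (m + l)) n g))
      (fracTaylor a γ (m * γ + β) c (m + n) g) (Icc a b) := by
  intro t ht
  have hsum : gammaSum a (m + n) c (fun i => i * γ) t = gammaSum a m c (fun i => i * γ) t +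
      gammaSum a n (fun l => c (m + l)) (fun l => l * γ + m * γ) t := by
    simp only [gammaSum, Finset.sum_range_add, Nat.cast_add, add_mul, add_comm]
  rw [fracTaylor, rlIntegral_fracTaylor (by positivity) hγ hβ _ n hg ht, fracTaylor, hsum,
    add_assoc]

theorem fracTaylor_one_add (hγ : 0 ≤ γ) (hβ : 0 ≤ β) (c : ℕ → ℝ) (n : ℕ)
    (hg : ContinuousOn g (Icc a b)) {t : ℝ} (ht : t ∈ Icc a b) :
    fracTaylor a γ (γ + β) c (1 + n) g t =
      c 0 + rlIntegral a γ (fracTaylor a γ β (fun l => c (1 + l)) n g) t := by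
  simpa [fracTaylor_one] using (fracTaylor_fracTaylor hγ hβ c 1 n hg ht).symm

end FracTaylor

section IntegerOrder

theorem contDiffOn_succ_of_hasDerivWithinAt {𝕜 F : Type*} [NontriviallyNormedField 𝕜]
    [NormedAddCommGroup F] [NormedSpace 𝕜 F] {s : Set 𝕜} (hs : UniqueDiffOn 𝕜 s) {n : ℕ}
    {f f' : 𝕜 → F} (hf : ∀ x ∈ s, HasDerivWithinAt f (f' x) s x) (hf' : ContDiffOn 𝕜 n f' s) :
    ContDiffOn 𝕜 (n + 1 : ℕ) f s := by
  push_cast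
  rw [contDiffOn_succ_iff_derivWithin hs]
  exact ⟨fun x hx => (hf x hx).differentiableWithinAt, by simp,
    hf'.congr fun x hx => (hf x hx).derivWithin (hs x hx)⟩

theorem iteratedDerivWithin_succ_eqOn {𝕜 F : Type*} [NontriviallyNormedField 𝕜]
    [NormedAddCommGroup F] [NormedSpace 𝕜 F] {s : Set 𝕜} (hs : UniqueDiffOn 𝕜 s) (n : ℕ)
    {f f' : 𝕜 → F} (hf : ∀ x ∈ s, HasDerivWithinAt f (f' x) s x) :
    EqOn (iteratedDerivWithin (n + 1) f s) (iteratedDerivWithin n f' s) s := by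
  rw [iteratedDerivWithin_succ']
  exact iteratedDerivWithin_congr fun x hx => (hf x hx).derivWithin (hs x hx)

variable {a b α β : ℝ} {f g y : ℝ → ℝ}

theorem hasDerivWithinAt_rlIntegral_one (hf : ContinuousOn f (Icc a b)) {x : ℝ}
    (hx : x ∈ Icc a b) : HasDerivWithinAt (rlIntegral a 1 f) (f x) (Icc a b) x := by
  have hint : IntervalIntegrable f volume a x := by
    refine (hf.mono ?_).intervalIntegrable
    rw [uIcc_of_le hx.1]
    exact Icc_subset_Icc_right hx.2
  have : Fact (x ∈ Icc a b) := ⟨hx⟩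
  have hderiv := intervalIntegral.integral_hasDerivWithinAt_right hint (s := Icc a b)
    (t := Icc a b) (hf.stronglyMeasurableAtFilter_nhdsWithin measurableSet_Icc x) (hf x hx)
  exact hderiv.congr_of_mem (fun y _ => rlIntegral_one a f y) hx

theorem eq_add_rlIntegral_one_of_hasDerivWithinAt {y' : ℝ → ℝ} (hy' : ContinuousOn y' (Icc a b))
    (hy : ∀ t ∈ Icc a b, HasDerivWithinAt y (y' t) (Icc a b) t) {t : ℝ} (ht : t ∈ Icc a b) :
    y t = y a + rlIntegral a 1 y' t := by
  have hsub : Icc a t ⊆ Icc a b := Icc_subset_Icc_right ht.2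
  rw [rlIntegral_one, intervalIntegral.integral_eq_sub_of_hasDeriv_right_of_le (f := y) ht.1
    (fun s hs => ((hy s (hsub hs)).continuousWithinAt.mono hsub)) (fun s hs => ?_)
    ((hy'.mono (uIcc_of_le ht.1 ▸ hsub)).intervalIntegrable), add_sub_cancel]
  have hsb : s < b := hs.2.trans_le ht.2
  exact ((hy s ⟨hs.1.le, hsb.le⟩).hasDerivAt (Icc_mem_nhds hs.1 hsb)).hasDerivWithinAt

theorem hasDerivWithinAt_fracTaylor (hβ : 0 ≤ β) (c : ℕ → ℝ) (n : ℕ)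
    (hg : ContinuousOn g (Icc a b)) {x : ℝ} (hx : x ∈ Icc a b) :
    HasDerivWithinAt (fracTaylor a 1 (1 + β) c (1 + n) g)
      (fracTaylor a 1 β (fun l => c (1 + l)) n g x) (Icc a b) x :=
  ((hasDerivWithinAt_rlIntegral_one (continuousOn_fracTaylor zero_le_one hβ _ n hg) hx).const_add
    (c 0)).congr_of_mem (fun _ ht => fracTaylor_one_add zero_le_one hβ c n hg ht) hx

theorem contDiffOn_fracTaylor (hab : a < b) (hβ : 0 ≤ β) (c : ℕ → ℝ) (i n : ℕ)
    (hg : ContinuousOn g (Icc a b)) :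
    ContDiffOn ℝ i (fracTaylor a 1 (i + β) c (i + n) g) (Icc a b) := by
  induction i generalizing c with
  | zero =>
    simpa using continuousOn_fracTaylor zero_le_one hβ c n hg
  | succ i ih =>
    have hderiv := fun x hx => hasDerivWithinAt_fracTaylor (β := i + β) (by positivity) c (i + n)
      hg (x := x) hx
    rw [show ((i + 1 : ℕ) : ℝ) + β = 1 + (i + β) by push_cast; ring, add_comm i 1, add_assoc,
      add_comm 1 i]
    exact contDiffOn_succ_of_hasDerivWithinAt (uniqueDiffOn_Icc hab) hderiv (ih _)

theorem iteratedDerivWithin_fracTaylor (hab : a < b) (hβ : 0 ≤ β) (c : ℕ → ℝ) (i n : ℕ)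
    (hg : ContinuousOn g (Icc a b)) :
    EqOn (iteratedDerivWithin i (fracTaylor a 1 (i + β) c (i + n) g) (Icc a b))
      (fracTaylor a 1 β (fun l => c (i + l)) n g) (Icc a b) := by
  induction i generalizing c with
  | zero => simp [EqOn]
  | succ i ih =>
    have hderiv := fun x hx => hasDerivWithinAt_fracTaylor (β := i + β) (by positivity) c (i + n)
      hg (x := x) hx
    rw [show ((i + 1 : ℕ) : ℝ) + β = 1 + (i + β) by push_cast; ring,
      show i + 1 + n = 1 + (i + n) by ring]
    refine (iteratedDerivWithin_succ_eqOn (uniqueDiffOn_Icc hab) i hderiv).trans ?_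
    simpa only [← add_assoc, add_comm 1 i] using ih fun l => c (1 + l)

theorem contDiffOn_rlIntegral (hab : a < b) (hβ : 0 ≤ β) (i : ℕ)
    (hg : ContinuousOn g (Icc a b)) : ContDiffOn ℝ i (rlIntegral a (i + β) g) (Icc a b) := by
  simpa only [fracTaylor_zero_coeff] using contDiffOn_fracTaylor hab hβ (fun _ => 0) i 0 hg

theorem iteratedDerivWithin_rlIntegral (hab : a < b) (hβ : 0 ≤ β) (i : ℕ)
    (hg : ContinuousOn g (Icc a b)) :
    EqOn (iteratedDerivWithin i (rlIntegral a (i + β) g) (Icc a b)) (rlIntegral a β g)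
      (Icc a b) := by
  simpa only [fracTaylor_zero_coeff] using
    iteratedDerivWithin_fracTaylor hab hβ (fun _ => 0) i 0 hg

theorem eqOn_fracTaylor_of_contDiffOn (hab : a < b) {n : ℕ} (hy : ContDiffOn ℝ n y (Icc a b)) :
    EqOn y (fracTaylor a 1 n (fun i => iteratedDerivWithin i y (Icc a b) a) n
      (iteratedDerivWithin n y (Icc a b))) (Icc a b) := by
  have hu := uniqueDiffOn_Icc hab
  induction n generalizing y with
  | zero => simp [EqOn, fracTaylor_zero]
  | succ n ih =>
    have hcont := hy.continuousOn_iteratedDerivWithin le_rfl hu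
    push_cast at hy
    obtain ⟨hdiff, -, hderiv⟩ := (contDiffOn_succ_iff_derivWithin hu).1 hy
    intro t ht
    rw [eq_add_rlIntegral_one_of_hasDerivWithinAt hderiv.continuousOn
      (fun s hs => (hdiff s hs).hasDerivWithinAt) ht, rlIntegral_congr 1 (ih hderiv) ht]
    simp only [← iteratedDerivWithin_succ']
    push_cast
    rw [add_comm (n : ℝ), add_comm n, fracTaylor_one_add zero_le_one n.cast_nonneg _ n
      (add_comm n 1 ▸ hcont) ht, iteratedDerivWithin_zero]
    simp only [add_comm 1]

theorem eqOn_of_eqOn_rlIntegral (hab : a < b) (hα : 0 ≤ α) (hf : ContinuousOn f (Icc a b))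
    (hg : ContinuousOn g (Icc a b)) (h : EqOn (rlIntegral a α f) (rlIntegral a α g) (Icc a b)) :
    EqOn f g (Icc a b) := by
  have hδ : 0 ≤ (⌈α⌉₊ : ℝ) - α := sub_nonneg.2 (Nat.le_ceil α)
  have hnat : EqOn (rlIntegral a ⌈α⌉₊ f) (rlIntegral a ⌈α⌉₊ g) (Icc a b) := fun t ht => by
    rw [← sub_add_cancel (⌈α⌉₊ : ℝ) α, ← rlIntegral_rlIntegral hδ hα hf ht,
      ← rlIntegral_rlIntegral hδ hα hg ht, rlIntegral_congr _ h ht]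
  have hderiv := fun {u : ℝ → ℝ} => iteratedDerivWithin_rlIntegral (g := u) hab le_rfl ⌈α⌉₊
  simp only [add_zero, rlIntegral_zero] at hderiv
  exact ((hderiv hf).symm.trans (iteratedDerivWithin_congr hnat)).trans (hderiv hg)

end IntegerOrder

section CaputoDerivative

variable {a b α β : ℝ} {c : ℕ → ℝ} {n : ℕ} {g x : ℝ → ℝ}

theorem caputoDeriv_zero (a b : ℝ) (x : ℝ → ℝ) : caputoDeriv a b 0 x = x :=
  funext fun _ => if_pos rfl

theorem caputoDeriv_of_ne_zero (a b : ℝ) (hα : α ≠ 0) (x : ℝ → ℝ) :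
    caputoDeriv a b α x =
      iteratedDerivWithin ⌈α⌉₊ (rlIntegral a (⌈α⌉₊ - α) (subTaylor a b α x)) (Icc a b) := by
  ext t
  rw [caputoDeriv, if_neg hα, rlDeriv, if_neg hα]

theorem contCaputoDiff_zero : ContCaputoDiff a b 0 x ↔ ContinuousOn x (Icc a b) := by
  simp [ContCaputoDiff]

theorem contCaputoDiff_iff_of_ne_zero (hα : α ≠ 0) :
    ContCaputoDiff a b α x ↔ ContDiffOn ℝ (⌈α⌉₊ - 1 : ℕ) x (Icc a b) ∧
      ContinuousOn (subTaylor a b α x) (Icc a b) ∧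
        ContDiffOn ℝ ⌈α⌉₊ (rlIntegral a (⌈α⌉₊ - α) (subTaylor a b α x)) (Icc a b) := by
  simp [ContCaputoDiff, ContRLDiff, hα]

theorem ContCaputoDiff.continuousOn (hx : ContCaputoDiff a b α x) :
    ContinuousOn x (Icc a b) := by
  rcases eq_or_ne α 0 with rfl | hα
  · exact contCaputoDiff_zero.1 hx
  · exact ((contCaputoDiff_iff_of_ne_zero hα).1 hx).1.continuousOn

theorem ContCaputoDiff.continuousOn_caputoDeriv (hab : a < b) (hx : ContCaputoDiff a b α x) :
    ContinuousOn (caputoDeriv a b α x) (Icc a b) := by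
  rcases eq_or_ne α 0 with rfl | hα
  · rw [caputoDeriv_zero]
    exact contCaputoDiff_zero.1 hx
  · rw [caputoDeriv_of_ne_zero a b hα]
    exact ((contCaputoDiff_iff_of_ne_zero hα).1 hx).2.2.continuousOn_iteratedDerivWithin le_rfl
      (uniqueDiffOn_Icc hab)

theorem subTaylor_eq_sub_gammaSum (b : ℝ) (hα : 0 < α) (x : ℝ → ℝ) (t : ℝ) :
    subTaylor a b α x t =
      x t - gammaSum a ⌈α⌉₊ (fun i => iteratedDerivWithin i x (Icc a b) a) (fun i => i) t := by
  rw [subTaylor, taylor_within_apply, Nat.sub_add_cancel (Nat.ceil_pos.2 hα)]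
  refine congrArg (x t - ·) (Finset.sum_congr rfl fun i _ => ?_)
  rw [gammaPow_natCast, smul_eq_mul]
  ring

theorem iteratedDerivWithin_fracTaylor_left (hab : a < b) {i : ℕ} (hi : i < n) (hiβ : i < β)
    (c : ℕ → ℝ) (hg : ContinuousOn g (Icc a b)) :
    iteratedDerivWithin i (fracTaylor a 1 β c n g) (Icc a b) a = c i := by
  have hderiv := iteratedDerivWithin_fracTaylor hab (sub_nonneg.2 hiβ.le) c i (n - i) hg
    (left_mem_Icc.2 hab.le)
  rwa [add_sub_cancel, Nat.add_sub_cancel' hi.le, fracTaylor_apply_left one_pos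
    (sub_pos.2 hiβ).ne' _ (Nat.sub_pos_of_lt hi)] at hderiv

/-- `x` is a continuously Caputo `α`-differentiable function on `[a,b]` with derivative `g` and
initial data `(D^i x)(a) = c i`, `i < ⌈α⌉`. -/
structure IsCaputoPrimitive (a b α : ℝ) (c : ℕ → ℝ) (g x : ℝ → ℝ) : Prop where
  contDiff : ContCaputoDiff a b α x
  deriv_eqOn : EqOn (caputoDeriv a b α x) g (Icc a b)
  initial : ∀ i < ⌈α⌉₊, iteratedDerivWithin i x (Icc a b) a = c i

theorem isCaputoPrimitive_of_eqOn_fracTaylor (hab : a < b) (hα : 0 ≤ α)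
    (hg : ContinuousOn g (Icc a b)) (hx : EqOn x (fracTaylor a 1 α c ⌈α⌉₊ g) (Icc a b)) :
    IsCaputoPrimitive a b α c g x := by
  rcases hα.eq_or_lt with rfl | hα
  · rw [Nat.ceil_zero, fracTaylor_zero] at hx
    exact ⟨contCaputoDiff_zero.2 (hg.congr hx), by rwa [caputoDeriv_zero], by simp⟩
  have hinit : ∀ i < ⌈α⌉₊, iteratedDerivWithin i x (Icc a b) a = c i := fun i hi => by
    rw [iteratedDerivWithin_congr hx (left_mem_Icc.2 hab.le),
      iteratedDerivWithin_fracTaylor_left hab hi (Nat.lt_ceil.1 hi) c hg]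
  have hsmooth : ContDiffOn ℝ (⌈α⌉₊ - 1 : ℕ) x (Icc a b) := by
    have hpred : ((⌈α⌉₊ - 1 : ℕ) : ℝ) < α :=
      Nat.lt_ceil.1 (Nat.sub_lt (Nat.ceil_pos.2 hα) one_pos)
    have h := contDiffOn_fracTaylor hab (sub_nonneg.2 hpred.le) c (⌈α⌉₊ - 1) 1 hg
    rw [add_sub_cancel, Nat.sub_add_cancel (Nat.ceil_pos.2 hα)] at h
    exact h.congr hx
  have hsub : EqOn (subTaylor a b α x) (rlIntegral a α g) (Icc a b) := fun t ht => by
    rw [subTaylor_eq_sub_gammaSum b hα, sub_eq_iff_eq_add', hx ht, fracTaylor, add_left_inj]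
    exact Finset.sum_congr rfl fun i hi => by simp only [hinit i (Finset.mem_range.1 hi), mul_one]
  have hJ : EqOn (rlIntegral a (⌈α⌉₊ - α) (subTaylor a b α x)) (rlIntegral a (⌈α⌉₊ + 0) g)
      (Icc a b) := fun t ht => by
    rw [rlIntegral_congr _ hsub ht, rlIntegral_rlIntegral (sub_nonneg.2 (Nat.le_ceil α)) hα.le hg
      ht, sub_add_cancel, add_zero]
  refine ⟨(contCaputoDiff_iff_of_ne_zero hα.ne').2 ⟨hsmooth,
    (continuousOn_rlIntegral hα.le hg).congr hsub,
    (contDiffOn_rlIntegral hab le_rfl ⌈α⌉₊ hg).congr hJ⟩, fun t ht => ?_, hinit⟩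
  rw [caputoDeriv_of_ne_zero a b hα.ne', iteratedDerivWithin_congr hJ ht,
    iteratedDerivWithin_rlIntegral hab le_rfl ⌈α⌉₊ hg ht, rlIntegral_zero]

theorem subTaylor_eqOn_rlIntegral (hab : a < b) (hα : 0 < α)
    (hx : ContDiffOn ℝ (⌈α⌉₊ - 1 : ℕ) x (Icc a b)) :
    EqOn (subTaylor a b α x) (rlIntegral a (⌈α⌉₊ - 1 : ℕ) fun t =>
      iteratedDerivWithin (⌈α⌉₊ - 1) x (Icc a b) t -
        iteratedDerivWithin (⌈α⌉₊ - 1) x (Icc a b) a) (Icc a b) := by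
  obtain ⟨n, hn⟩ := Nat.exists_eq_add_of_le' (Nat.ceil_pos.2 hα)
  intro t ht
  rw [subTaylor_eq_sub_gammaSum b hα]
  simp only [hn, Nat.succ_eq_add_one, zero_add, add_tsub_cancel_right] at hx ⊢
  have hcont := hx.continuousOn_iteratedDerivWithin le_rfl (uniqueDiffOn_Icc hab)
  set v := iteratedDerivWithin n x (Icc a b)
  have hsplit : EqOn v (fracTaylor a 1 0 (fun l => iteratedDerivWithin (n + l) x (Icc a b) a) 1
      fun s => v s - v a) (Icc a b) := fun s _ => by
    rw [fracTaylor_one, rlIntegral_zero, add_zero, add_sub_cancel]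
  have hcomp := fracTaylor_fracTaylor (g := fun s => v s - v a) zero_le_one le_rfl
    (fun i => iteratedDerivWithin i x (Icc a b) a) n 1 (hcont.fun_sub continuousOn_const) ht
  rw [eqOn_fracTaylor_of_contDiffOn hab hx ht, fracTaylor_congr a 1 n (fun _ _ => rfl) hsplit ht]
  rw [mul_one] at hcomp
  rw [hcomp, fracTaylor, add_zero]
  simp only [mul_one, add_sub_cancel_left]

theorem iteratedDerivWithin_rlIntegral_subTaylor_left (hab : a < b) (hα : 0 < α)
    (hx : ContDiffOn ℝ (⌈α⌉₊ - 1 : ℕ) x (Icc a b)) {i : ℕ} (hi : i < ⌈α⌉₊) :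
    iteratedDerivWithin i (rlIntegral a (⌈α⌉₊ - α) (subTaylor a b α x)) (Icc a b) a = 0 := by
  have hδ : 0 ≤ (⌈α⌉₊ : ℝ) - α := sub_nonneg.2 (Nat.le_ceil α)
  have ha : a ∈ Icc a b := left_mem_Icc.2 hab.le
  set v := fun t => iteratedDerivWithin (⌈α⌉₊ - 1) x (Icc a b) t -
    iteratedDerivWithin (⌈α⌉₊ - 1) x (Icc a b) a with hv
  have hcont : ContinuousOn v (Icc a b) :=
    (hx.continuousOn_iteratedDerivWithin le_rfl (uniqueDiffOn_Icc hab)).fun_sub continuousOn_const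
  have hleft : rlIntegral a (⌈α⌉₊ - α) v a = 0 := rlIntegral_apply_left (.inr (by simp [hv]))
  obtain ⟨j, hj⟩ := Nat.exists_eq_add_of_le (Nat.le_sub_one_of_lt hi)
  have hcomm : EqOn (rlIntegral a (⌈α⌉₊ - α) (subTaylor a b α x))
      (rlIntegral a (i + j) (rlIntegral a (⌈α⌉₊ - α) v)) (Icc a b) := fun t ht => by
    rw [rlIntegral_congr _ (subTaylor_eqOn_rlIntegral hab hα hx) ht,
      rlIntegral_rlIntegral hδ (Nat.cast_nonneg _) hcont ht, hj,
      rlIntegral_rlIntegral (by positivity) hδ hcont ht, Nat.cast_add, add_comm]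
  rw [iteratedDerivWithin_congr hcomm ha, iteratedDerivWithin_rlIntegral hab j.cast_nonneg i
    (continuousOn_rlIntegral hδ hcont) ha, rlIntegral_apply_left (.inr hleft)]

theorem ContCaputoDiff.eqOn_fracTaylor (hab : a < b) (hα : 0 ≤ α)
    (hx : ContCaputoDiff a b α x) :
    EqOn x (fracTaylor a 1 α (fun i => iteratedDerivWithin i x (Icc a b) a) ⌈α⌉₊
      (caputoDeriv a b α x)) (Icc a b) := by
  have hgc := hx.continuousOn_caputoDeriv hab
  rcases hα.eq_or_lt with rfl | hα
  · simp [EqOn, fracTaylor_zero, caputoDeriv_zero]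
  have hδ : 0 ≤ (⌈α⌉₊ : ℝ) - α := sub_nonneg.2 (Nat.le_ceil α)
  obtain ⟨hsmooth, hyc, hw⟩ := (contCaputoDiff_iff_of_ne_zero hα.ne').1 hx
  have hwJ : EqOn (rlIntegral a (⌈α⌉₊ - α) (subTaylor a b α x))
      (rlIntegral a ⌈α⌉₊ (caputoDeriv a b α x)) (Icc a b) := fun t ht => by
    rw [eqOn_fracTaylor_of_contDiffOn hab hw ht, ← caputoDeriv_of_ne_zero a b hα.ne',
      fracTaylor_congr a 1 _ (fun i hi => iteratedDerivWithin_rlIntegral_subTaylor_left hab hα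
        hsmooth hi) (fun _ _ => rfl) ht, fracTaylor_zero_coeff]
  have hy : EqOn (subTaylor a b α x) (rlIntegral a α (caputoDeriv a b α x)) (Icc a b) :=
    eqOn_of_eqOn_rlIntegral hab hδ hyc (continuousOn_rlIntegral hα.le hgc) fun t ht => by
      rw [hwJ ht, rlIntegral_rlIntegral hδ hα.le hgc ht, sub_add_cancel]
  intro t ht
  rw [fracTaylor, ← hy ht, subTaylor_eq_sub_gammaSum b hα]
  simp only [mul_one, add_sub_cancel]

theorem isCaputoPrimitive_iff (hab : a < b) (hα : 0 ≤ α) (hg : ContinuousOn g (Icc a b)) :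
    IsCaputoPrimitive a b α c g x ↔ EqOn x (fracTaylor a 1 α c ⌈α⌉₊ g) (Icc a b) := by
  refine ⟨fun h => ?_, isCaputoPrimitive_of_eqOn_fracTaylor hab hα hg⟩
  exact (h.contDiff.eqOn_fracTaylor hab hα).trans (fracTaylor_congr a 1 α h.initial h.deriv_eqOn)

end CaputoDerivative

section Volterra

theorem existsUnique_fixedPoint_of_weighted_contraction {X E : Type*} [TopologicalSpace X]
    [NormedAddCommGroup E] [NormedSpace ℝ E] [CompleteSpace E] {s : Set X} (hs : IsCompact s)
    {w : X → ℝ} (hw : ContinuousOn w s) (hw0 : ∀ t ∈ s, 0 < w t) {K : ℝ≥0} (hK : K < 1)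
    {T : (X → E) → X → E} (hT : ∀ g, ContinuousOn g s → ContinuousOn (T g) s)
    (hlip : ∀ g h, ContinuousOn g s → ContinuousOn h s → ∀ D : ℝ,
      (∀ t ∈ s, ‖g t - h t‖ ≤ D * w t) → ∀ t ∈ s, ‖T g t - T h t‖ ≤ K * D * w t) :
    ∃ g, (ContinuousOn g s ∧ EqOn g (T g) s) ∧
      ∀ g', ContinuousOn g' s → EqOn g' (T g') s → EqOn g' g s := by
  have : CompactSpace s := isCompact_iff_compactSpace.1 hs
  have hcongr : ∀ g h, ContinuousOn g s → ContinuousOn h s → EqOn g h s → EqOn (T g) (T h) s :=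
    fun g h hg hh hgh t ht => by
      simpa [sub_eq_zero] using hlip g h hg hh 0 (fun u hu => by simp [hgh hu]) t ht
  have hdiv : ∀ {u : X → E}, ContinuousOn u s → ContinuousOn (fun t => (w t)⁻¹ • u t) s :=
    fun hu => (hw.inv₀ fun t ht => (hw0 t ht).ne').smul hu
  -- For `g = w • h` the weighted norm of `g` is the sup norm of `h`.
  set lift : C(s, E) → X → E := fun h t => w t • Function.extend Subtype.val h 0 t
  have hlift : ∀ h t (ht : t ∈ s), lift h t = w t • h ⟨t, ht⟩ := fun h t ht =>
    congrArg (w t • ·) (Subtype.val_injective.extend_apply h 0 ⟨t, ht⟩)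
  have hliftc : ∀ h, ContinuousOn (lift h) s := fun h => by
    refine hw.smul (continuousOn_iff_continuous_domRestrict.2 (h.continuous.congr fun t => ?_))
    exact (Subtype.val_injective.extend_apply h 0 t).symm
  set Φ : C(s, E) → C(s, E) := fun h => ⟨_, (hdiv (hT _ (hliftc h))).domRestrict⟩
  have hΦ : ContractingWith K Φ := by
    refine ⟨hK, LipschitzWith.of_dist_le_mul fun h h' => ?_⟩
    refine (ContinuousMap.dist_le (by positivity)).2 fun ⟨t, ht⟩ => ?_
    have hle := hlip _ _ (hliftc h) (hliftc h') (dist h h') (fun u hu => by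
      rw [hlift h u hu, hlift h' u hu, ← smul_sub, norm_smul, Real.norm_of_nonneg (hw0 u hu).le,
        mul_comm, ← dist_eq_norm]
      exact mul_le_mul_of_nonneg_right (ContinuousMap.dist_apply_le_dist _) (hw0 u hu).le) t ht
    change dist ((w t)⁻¹ • T (lift h) t) ((w t)⁻¹ • T (lift h') t) ≤ _
    rwa [dist_smul₀, norm_inv, Real.norm_of_nonneg (hw0 t ht).le, inv_mul_le_iff₀ (hw0 t ht),
      dist_eq_norm, mul_comm (w t)]
  refine ⟨lift (hΦ.fixedPoint Φ), ⟨hliftc _, fun t ht => ?_⟩, fun g' hg' hfix t ht => ?_⟩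
  · rw [hlift _ t ht]
    nth_rw 1 [← hΦ.fixedPoint_isFixedPt.eq]
    exact smul_inv_smul₀ (hw0 t ht).ne' _
  · set h : C(s, E) := ⟨_, (hdiv hg').domRestrict⟩
    have hg'h : EqOn (lift h) g' s := fun u hu =>
      (hlift h u hu).trans (smul_inv_smul₀ (hw0 u hu).ne' _)
    have hΦh : Φ h = h := ContinuousMap.ext fun u => congrArg ((w u)⁻¹ • ·)
      ((hcongr _ _ (hliftc h) hg' hg'h u.2).trans (hfix u.2).symm)
    rw [← hg'h ht, hΦ.fixedPoint_unique hΦh]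

theorem rlIntegral_exp_le {a x β lam : ℝ} (hβ : 0 < β) (hlam : 0 < lam) (hx : a ≤ x) :
    rlIntegral a β (fun t => Real.exp (lam * (t - a))) x ≤
      (1 / lam) ^ β * Real.exp (lam * (x - a)) := by
  have hΓ : 0 < Real.Gamma β := Real.Gamma_pos_of_pos hβ
  have hint : IntegrableOn (fun t : ℝ => t ^ (β - 1) * Real.exp (-(lam * t))) (Ioi 0) := by
    simpa using integrableOn_rpow_mul_exp_neg_mul_rpow (s := β - 1) (p := 1) (by linarith)
      one_pos hlam
  have hreflect : ∫ t in a..x, (x - t) ^ (β - 1) * Real.exp (lam * (t - a)) =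
      Real.exp (lam * (x - a)) * ∫ u in (0 : ℝ)..(x - a), u ^ (β - 1) * Real.exp (-(lam * u)) := by
    have h := intervalIntegral.integral_comp_sub_left (a := a) (b := x)
      (fun u => u ^ (β - 1) * Real.exp (-(lam * u))) x
    rw [sub_self] at h
    rw [← h, ← intervalIntegral.integral_const_mul]
    refine intervalIntegral.integral_congr fun t _ => ?_
    rw [show lam * (t - a) = lam * (x - a) + -(lam * (x - t)) by ring, Real.exp_add]
    ring
  have hgamma : ∫ u in (0 : ℝ)..(x - a), u ^ (β - 1) * Real.exp (-(lam * u)) ≤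
      (1 / lam) ^ β * Real.Gamma β := by
    rw [← Real.integral_rpow_mul_exp_neg_mul_Ioi hβ hlam,
      intervalIntegral.integral_of_le (sub_nonneg.2 hx)]
    refine setIntegral_mono_set hint ?_ Ioc_subset_Ioi_self.eventuallyLE
    filter_upwards [ae_restrict_mem measurableSet_Ioi] with t ht
    exact mul_nonneg (Real.rpow_nonneg (le_of_lt ht) _) (Real.exp_pos _).le
  rw [rlIntegral_of_ne_zero a hβ.ne', hreflect, one_div_mul_eq_div, div_le_iff₀ hΓ]
  refine (mul_le_mul_of_nonneg_left hgamma (Real.exp_pos _).le).trans_eq ?_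
  ring

theorem exists_pos_forall_one_div_rpow_le {ι : Type*} [Finite ι] {β : ι → ℝ}
    (hβ : ∀ i, 0 < β i) {ε : ℝ} (hε : 0 < ε) :
    ∃ lam : ℝ, 0 < lam ∧ ∀ i, (1 / lam) ^ β i ≤ ε := by
  have hev : ∀ᶠ lam : ℝ in atTop, ∀ i, lam ^ (-β i) ≤ ε := eventually_all.2 fun i =>
    (tendsto_rpow_neg_atTop (hβ i)).eventually_le_const hε
  obtain ⟨lam, hle, hlam⟩ := (hev.and (eventually_gt_atTop 0)).exists
  refine ⟨lam, hlam, fun i => ?_⟩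
  rw [one_div, Real.inv_rpow hlam.le, ← Real.rpow_neg hlam.le]
  exact hle i

theorem continuousOn_comp_pi {X Y ι : Type*} {E : ι → Type*} [TopologicalSpace X]
    [TopologicalSpace Y] [∀ i, TopologicalSpace (E i)] {s : Set X} {f : X → (∀ i, E i) → Y}
    (hf : ContinuousOn (Function.uncurry f) (s ×ˢ univ)) {y : ∀ i, X → E i}
    (hy : ∀ i, ContinuousOn (y i) s) : ContinuousOn (fun t => f t fun i => y i t) s :=
  hf.comp (f := fun t => (t, fun i => y i t)) (continuousOn_id.prodMk (continuousOn_pi.2 hy))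
    fun _ ht => ⟨ht, trivial⟩

theorem existsUnique_volterra {a b : ℝ} {ι : Type*} [Fintype ι] {f : ℝ → (ι → ℝ) → ℝ}
    (hf : ContinuousOn (Function.uncurry f) (Icc a b ×ˢ univ)) {K : ℝ≥0}
    (hK : ∀ t ∈ Icc a b, LipschitzWith K (f t)) {p : ι → ℝ → ℝ}
    (hp : ∀ i, ContinuousOn (p i) (Icc a b)) {β : ι → ℝ} (hβ : ∀ i, 0 < β i) :
    ∃ g, (ContinuousOn g (Icc a b) ∧
        ∀ t ∈ Icc a b, g t = f t fun i => p i t + rlIntegral a (β i) g t) ∧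
      ∀ g', ContinuousOn g' (Icc a b) →
        (∀ t ∈ Icc a b, g' t = f t fun i => p i t + rlIntegral a (β i) g' t) →
        EqOn g' g (Icc a b) := by
  obtain ⟨lam, hlam, hsmall⟩ :=
    exists_pos_forall_one_div_rpow_le hβ (ε := 1 / (2 * (K + 1))) (by positivity)
  refine existsUnique_fixedPoint_of_weighted_contraction isCompact_Icc
    (w := fun t => Real.exp (lam * (t - a))) (by fun_prop) (fun _ _ => Real.exp_pos _)
    (K := 1 / 2) (by norm_num) (T := fun g t => f t fun i => p i t + rlIntegral a (β i) g t)
    (fun g hg => continuousOn_comp_pi hf fun i => (hp i).add (continuousOn_rlIntegral (hβ i).le hg))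
    fun g h hg hh D hD t ht => ?_
  have hD0 : 0 ≤ D := nonneg_of_mul_nonneg_left ((norm_nonneg _).trans (hD t ht)) (Real.exp_pos _)
  have hcoord : ∀ i, dist (p i t + rlIntegral a (β i) g t) (p i t + rlIntegral a (β i) h t) ≤
      D * (1 / (2 * (K + 1)) * Real.exp (lam * (t - a))) := fun i => by
    rw [dist_add_left, Real.dist_eq, ← rlIntegral_sub (hβ i).le ht hg hh]
    refine (abs_rlIntegral_le (hβ i).le ht (hg.fun_sub hh) (by fun_prop) hD).trans ?_
    rw [rlIntegral_const_mul]
    gcongr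
    exact (rlIntegral_exp_le (hβ i) hlam ht.1).trans
      (mul_le_mul_of_nonneg_right (hsmall i) (Real.exp_pos _).le)
  rw [← dist_eq_norm]
  calc _ ≤ K * (D * (1 / (2 * (K + 1)) * Real.exp (lam * (t - a)))) :=
        ((hK t ht).dist_le_mul _ _).trans
          (mul_le_mul_of_nonneg_left ((dist_pi_le_iff (by positivity)).2 hcoord) K.2)
    _ = K / (K + 1) * (1 / 2 * D * Real.exp (lam * (t - a))) := by field_simp
    _ ≤ 1 * (1 / 2 * D * Real.exp (lam * (t - a))) := by
        gcongr
        exact (div_le_one (by positivity)).2 (by linarith)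
    _ = _ := by simp

end Volterra

section Chain

variable {a b γ : ℝ} {c : ℕ → ℝ} {N j : ℕ} {g g' : ℝ → ℝ}

/-- The member `x_j` of the chain `x_N = g`, `x_j = c j + J_a^γ x_{j+1}` for `j < N`. -/
def chainMember (a γ : ℝ) (c : ℕ → ℝ) (N : ℕ) (g : ℝ → ℝ) (j : ℕ) : ℝ → ℝ :=
  fracTaylor a γ ((N - j : ℕ) * γ) (fun l => c (j + l)) (N - j) g

theorem chainMember_self (a γ : ℝ) (c : ℕ → ℝ) (N : ℕ) (g : ℝ → ℝ) :
    chainMember a γ c N g N = g := by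
  simp [chainMember, fracTaylor_zero]

theorem chainMember_congr (a γ : ℝ) (c : ℕ → ℝ) (N j : ℕ) (h : EqOn g g' (Icc a b)) :
    EqOn (chainMember a γ c N g j) (chainMember a γ c N g' j) (Icc a b) :=
  fracTaylor_congr a γ _ (fun _ _ => rfl) h

theorem continuousOn_chainMember (hγ : 0 ≤ γ) (c : ℕ → ℝ) (N j : ℕ)
    (hg : ContinuousOn g (Icc a b)) : ContinuousOn (chainMember a γ c N g j) (Icc a b) :=
  continuousOn_fracTaylor hγ (by positivity) _ _ hg

theorem chainMember_eq_add (hγ : 0 ≤ γ) (hg : ContinuousOn g (Icc a b)) (hj : j < N) {t : ℝ}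
    (ht : t ∈ Icc a b) :
    chainMember a γ c N g j t = c j + rlIntegral a γ (chainMember a γ c N g (j + 1)) t := by
  obtain ⟨n, rfl⟩ := Nat.exists_eq_add_of_lt hj
  have h := fracTaylor_one_add hγ (β := n * γ) (by positivity) (fun l => c (j + l)) n hg ht
  rw [chainMember, chainMember, show j + n + 1 - j = 1 + n by omega,
    show j + n + 1 - (j + 1) = n by omega]
  simpa [add_mul, add_assoc] using h

theorem chainMember_zero_eqOn (hγ : 0 ≤ γ) (hg : ContinuousOn g (Icc a b)) (hj : j ≤ N) :
    EqOn (chainMember a γ c N g 0) (fracTaylor a γ (j * γ) c j (chainMember a γ c N g j))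
      (Icc a b) := by
  obtain ⟨n, rfl⟩ := Nat.exists_eq_add_of_le hj
  have h := fracTaylor_fracTaylor hγ (β := n * γ) (by positivity) c j n hg
  simpa [chainMember, add_mul] using h.symm

/-- The initial values `x_j(a)` of the system of order `1 / M` belonging to the initial values `ξ`
of the multi-term problem. -/
def initVal (M : ℕ) (ξ : ℕ → ℝ) (j : ℕ) : ℝ := if M ∣ j then ξ (j / M) else 0

variable {M : ℕ} {ξ : ℕ → ℝ} {x : ℝ → ℝ}

theorem fracTaylor_initVal (hM : 0 < M) (a β : ℝ) (ξ : ℕ → ℝ) (j : ℕ) (g : ℝ → ℝ) :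
    fracTaylor a (1 / M) β (initVal M ξ) j g = fracTaylor a 1 β ξ ⌈(j : ℝ) / M⌉₊ g := by
  have hM' : (0 : ℝ) < M := by exact_mod_cast hM
  have hlt : ∀ q : ℕ, q < ⌈(j : ℝ) / M⌉₊ ↔ M * q < j := fun q => by
    rw [Nat.lt_ceil, lt_div_iff₀ hM', mul_comm]
    exact_mod_cast Iff.rfl
  refine funext fun t => congrArg (· + rlIntegral a β g t) (Eq.symm ?_)
  refine Finset.sum_of_injOn (fun q => M * q) (fun p _ q _ h => Nat.eq_of_mul_eq_mul_left hM h)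
    (fun q hq => ?_) (fun l hl hl' => ?_) fun q _ => ?_
  · simpa [hlt] using hq
  · rw [initVal, if_neg, zero_mul]
    rintro ⟨q, rfl⟩
    exact hl' ⟨q, by simpa [hlt] using hl, rfl⟩
  · rw [initVal, if_pos (dvd_mul_right M q), Nat.mul_div_cancel_left q hM]
    congr 2
    push_cast
    field_simp

theorem isCaputoPrimitive_chainMember (hab : a < b) (hM : 0 < M) (hg : ContinuousOn g (Icc a b))
    (hj : j ≤ N) (hx : EqOn x (chainMember a (1 / M) (initVal M ξ) N g 0) (Icc a b)) :
    IsCaputoPrimitive a b (j / M) ξ (chainMember a (1 / M) (initVal M ξ) N g j) x := by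
  have hγ : (0 : ℝ) ≤ 1 / M := by positivity
  refine isCaputoPrimitive_of_eqOn_fracTaylor hab (by positivity)
    (continuousOn_chainMember hγ _ N j hg) ?_
  rw [← fracTaylor_initVal hM, ← mul_one_div (j : ℝ) (M : ℝ)]
  exact hx.trans (chainMember_zero_eqOn hγ hg hj)

theorem isCaputoPrimitive_iff_eqOn_chainMember_zero (hab : a < b) (hM : 0 < M)
    (hg : ContinuousOn g (Icc a b)) :
    IsCaputoPrimitive a b (N / M) ξ g x ↔
      EqOn x (chainMember a (1 / M) (initVal M ξ) N g 0) (Icc a b) := by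
  rw [isCaputoPrimitive_iff hab (by positivity) hg, ← fracTaylor_initVal hM]
  simp only [chainMember, zero_add, tsub_zero, mul_one_div]

theorem contCaputoDiff_and_eqOn_and_apply_left_iff {α y₀ : ℝ} (hab : a < b) (hα : 0 < α)
    (hα1 : α ≤ 1) (hg : ContinuousOn g (Icc a b)) :
    ContCaputoDiff a b α x ∧ EqOn (caputoDeriv a b α x) g (Icc a b) ∧ x a = y₀ ↔
      ∀ t ∈ Icc a b, x t = y₀ + rlIntegral a α g t := by
  have hceil : ⌈α⌉₊ = 1 := (Nat.ceil_le.2 (by simpa)).antisymm (Nat.ceil_pos.2 hα)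
  have hiff := isCaputoPrimitive_iff (c := fun _ => y₀) (x := x) hab hα.le hg
  simp only [hceil, EqOn, fracTaylor_one] at hiff
  rw [← hiff]
  exact ⟨fun ⟨h, hderiv, hleft⟩ => ⟨h, hderiv, by simpa [hceil] using hleft⟩,
    fun h => ⟨h.contDiff, h.deriv_eqOn, by simpa [hceil] using h.initial 0⟩⟩

end Chain

section Reduction

variable {a b : ℝ} {k : ℕ} {α : Fin (k + 1) → ℚ} {f : ℝ → (Fin k → ℝ) → ℝ} {ξ : ℕ → ℝ}
  {g x : ℝ → ℝ}

theorem cast_eq_scaled_div (h0 : α 0 = 0) (hα : StrictMono α) (i : Fin (k + 1)) :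
    (α i : ℝ) = scaled α i / lcmDen α := by
  have hM : (lcmDen α : ℚ) ≠ 0 := by exact_mod_cast (lcmDen_pos α).ne'
  have h := scaled_cast α i (h0 ▸ hα.monotone (Fin.zero_le i))
  rw [eq_div_of_mul_eq hM ((mul_comm _ _).trans h.symm)]
  push_cast
  rfl

theorem natCeil_ratCast (q : ℚ) : ⌈(q : ℝ)⌉₊ = ⌈q⌉₊ :=
  eq_of_forall_lt_iff fun n => by
    rw [Nat.lt_ceil, Nat.lt_ceil]
    exact_mod_cast Iff.rfl

/-- The chain `x_0, …, x_N` of order `γ = 1 / M` with `x_N = g` and the initial values of the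
reduced system. -/
abbrev reducedChain (a : ℝ) (α : Fin (k + 1) → ℚ) (ξ : ℕ → ℝ) (g : ℝ → ℝ) (j : ℕ) : ℝ → ℝ :=
  chainMember a (1 / lcmDen α) (initVal (lcmDen α) ξ) (dim α) g j

/-- The Volterra equation for the highest derivative `g` of a solution: the right-hand side `f` is
evaluated along the chain that `g` generates. -/
structure IsTopDerivative (a b : ℝ) (α : Fin (k + 1) → ℚ) (f : ℝ → (Fin k → ℝ) → ℝ) (ξ : ℕ → ℝ)
    (g : ℝ → ℝ) : Prop where
  continuousOn : ContinuousOn g (Icc a b)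
  equation : ∀ t ∈ Icc a b, g t = f t fun i => reducedChain a α ξ g (scaled α i.castSucc) t

theorem existsUnique_isTopDerivative (h0 : α 0 = 0) (hα : StrictMono α)
    (hf : ContinuousOn (Function.uncurry f) (Icc a b ×ˢ univ)) {K : ℝ≥0}
    (hK : ∀ t ∈ Icc a b, LipschitzWith K (f t)) (ξ : ℕ → ℝ) :
    ∃ g, IsTopDerivative a b α f ξ g ∧
      ∀ g', IsTopDerivative a b α f ξ g' → EqOn g' g (Icc a b) := by
  have hM : (0 : ℝ) < lcmDen α := by exact_mod_cast lcmDen_pos α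
  obtain ⟨g, ⟨hgc, hg⟩, huniq⟩ := existsUnique_volterra hf hK
    (p := fun i => gammaSum a (dim α - scaled α i.castSucc)
      (fun l => initVal (lcmDen α) ξ (scaled α i.castSucc + l)) fun l => l * (1 / lcmDen α))
    (β := fun i => (dim α - scaled α i.castSucc : ℕ) * (1 / lcmDen α))
    (fun i => (continuous_gammaSum a _ _ fun l => by positivity).continuousOn)
    fun i => mul_pos (by exact_mod_cast Nat.sub_pos_of_lt (scaled_lt α h0 hα i)) (by positivity)
  exact ⟨g, ⟨hgc, hg⟩, fun g' hg' => huniq g' hg'.continuousOn hg'.equation⟩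

theorem caputoDeriv_eqOn_reducedChain (hab : a < b) (h0 : α 0 = 0) (hα : StrictMono α)
    (hg : ContinuousOn g (Icc a b)) (hx : EqOn x (reducedChain a α ξ g 0) (Icc a b)) (i : Fin k) :
    EqOn (caputoDeriv a b (α i.castSucc) x) (reducedChain a α ξ g (scaled α i.castSucc))
      (Icc a b) := by
  rw [cast_eq_scaled_div h0 hα]
  exact (isCaputoPrimitive_chainMember hab (lcmDen_pos α) hg (scaled_lt α h0 hα i).le hx).deriv_eqOn

theorem isMultiTermSolution_iff (hab : a < b) (h0 : α 0 = 0) (hα : StrictMono α) :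
    IsMultiTermSolution a b α f ξ x ↔
      ∃ g, IsTopDerivative a b α f ξ g ∧ EqOn x (reducedChain a α ξ g 0) (Icc a b) := by
  have hiff := fun {g : ℝ → ℝ} => isCaputoPrimitive_iff_eqOn_chainMember_zero (g := g) (x := x)
    (N := dim α) (ξ := ξ) hab (lcmDen_pos α)
  rw [dim, ← cast_eq_scaled_div h0 hα] at hiff
  constructor
  · intro h
    have hg := h.contDiff.continuousOn_caputoDeriv hab
    have hx := (hiff hg).1
      ⟨h.contDiff, fun _ _ => rfl, by simpa only [natCeil_ratCast] using h.initial⟩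
    refine ⟨_, ⟨hg, fun t ht => ?_⟩, hx⟩
    rw [h.equation t ht]
    exact congrArg (f t) (funext fun i => caputoDeriv_eqOn_reducedChain hab h0 hα hg hx i ht)
  · rintro ⟨g, hg, hx⟩
    have hprim := (hiff hg.continuousOn).2 hx
    refine ⟨hprim.contDiff, fun t ht => ?_, by simpa only [natCeil_ratCast] using hprim.initial⟩
    rw [hprim.deriv_eqOn ht, hg.equation t ht]
    exact congrArg (f t) (funext fun i =>
      (caputoDeriv_eqOn_reducedChain hab h0 hα hg.continuousOn hx i ht).symm)

theorem one_div_lcmDen_mem_Ioc (α : Fin (k + 1) → ℚ) : 1 / (lcmDen α : ℝ) ∈ Ioc 0 1 := by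
  have hM : (1 : ℝ) ≤ lcmDen α := by exact_mod_cast lcmDen_pos α
  exact ⟨by positivity, (div_le_one (by positivity)).2 hM⟩

variable {h0 : α 0 = 0} {hα : StrictMono α} {X : Fin (dim α) → ℝ → ℝ}

theorem IsTopDerivative.isReducedSolution (hab : a < b) (hg : IsTopDerivative a b α f ξ g)
    (hX : ∀ j : Fin (dim α), EqOn (X j) (reducedChain a α ξ g j) (Icc a b)) :
    IsReducedSolution a b α h0 hα f ξ X := by
  obtain ⟨hγ, hγ1⟩ := one_div_lcmDen_mem_Ioc α
  have hstep := fun j : Fin (dim α) => (contCaputoDiff_and_eqOn_and_apply_left_iff hab hγ hγ1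
    (continuousOn_chainMember hγ.le _ _ (j + 1) hg.continuousOn)).2 fun t ht =>
      (hX j ht).trans (chainMember_eq_add hγ.le hg.continuousOn j.2 ht)
  refine ⟨fun j => (hstep j).1, fun i j hij t ht => ?_, fun j hj t ht => ?_,
    fun j => (hstep j).2.2⟩
  · rw [(hstep i).2.1 ht, hij, hX j ht]
  · rw [(hstep j).2.1 ht, hj, chainMember_self, hg.equation t ht]
    exact congrArg (f t) (funext fun i => (hX (termIndex α h0 hα i) ht).symm)

theorem IsReducedSolution.eqOn_reducedChain (hab : a < b)
    (h : IsReducedSolution a b α h0 hα f ξ X)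
    (hg : ContinuousOn (fun t => f t fun i => X (termIndex α h0 hα i) t) (Icc a b))
    (j : Fin (dim α)) :
    EqOn (X j) (reducedChain a α ξ (fun t => f t fun i => X (termIndex α h0 hα i) t) j)
      (Icc a b) := by
  obtain ⟨hγ, hγ1⟩ := one_div_lcmDen_mem_Ioc α
  have hstep := fun i => (contCaputoDiff_and_eqOn_and_apply_left_iff hab hγ hγ1
    ((h.contDiff i).continuousOn_caputoDeriv hab)).1 ⟨h.contDiff i, fun _ _ => rfl, h.initial i⟩
  obtain ⟨j, hj⟩ := j
  induction hj.le using Nat.decreasingInduction with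
  | self => exact absurd hj (lt_irrefl _)
  | of_succ j _ ih =>
    intro t ht
    rw [hstep ⟨j, hj⟩ t ht, reducedChain, chainMember_eq_add hγ.le hg hj ht]
    refine congrArg (initVal (lcmDen α) ξ j + ·) (rlIntegral_congr _ (fun s hs => ?_) ht)
    rcases (Nat.succ_le_of_lt hj).eq_or_lt with hj' | hj'
    · rw [h.equation ⟨j, hj⟩ hj' s hs, ← Nat.succ_eq_add_one, hj', chainMember_self]
    · rw [h.chain ⟨j, hj⟩ ⟨j + 1, hj'⟩ rfl s hs, ih hj' hs]

theorem isReducedSolution_iff (hab : a < b)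
    (hf : ContinuousOn (Function.uncurry f) (Icc a b ×ˢ univ)) :
    IsReducedSolution a b α h0 hα f ξ X ↔ ∃ g, IsTopDerivative a b α f ξ g ∧
      ∀ j : Fin (dim α), EqOn (X j) (reducedChain a α ξ g j) (Icc a b) := by
  refine ⟨fun h => ?_, fun ⟨g, hg, hX⟩ => hg.isReducedSolution hab hX⟩
  have hg := continuousOn_comp_pi hf fun i => (h.contDiff (termIndex α h0 hα i)).continuousOn
  have hX := h.eqOn_reducedChain hab hg
  exact ⟨_, ⟨hg, fun t ht => congrArg (f t) (funext fun i => hX (termIndex α h0 hα i) ht)⟩, hX⟩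

end Reduction

end Caputo

end

theorem corollary4p1_general (a b : ℝ) (hab : a < b) (k : ℕ) (hk : 0 < k)
    (α : Fin (k + 1) → ℚ) (h0 : α 0 = 0) (hα : StrictMono α) (f : ℝ → (Fin k → ℝ) → ℝ)
    (hf : ContinuousOn (Function.uncurry f) (Set.Icc a b ×ˢ Set.univ)) (K : ℝ≥0)
    (hK : ∀ t ∈ Set.Icc a b, LipschitzWith K (f t)) (ξ : ℕ → ℝ) :
    (∃ x, Caputo.IsMultiTermSolution a b α f ξ x ∧
      ∀ y, Caputo.IsMultiTermSolution a b α f ξ y → Set.EqOn y x (Set.Icc a b)) ∧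
    (∃ X, Caputo.IsReducedSolution a b α h0 hα f ξ X ∧
      ∀ Y, Caputo.IsReducedSolution a b α h0 hα f ξ Y → ∀ j, Set.EqOn (Y j) (X j) (Set.Icc a b)) ∧
    (∀ X, Caputo.IsReducedSolution a b α h0 hα f ξ X →
      Caputo.IsMultiTermSolution a b α f ξ (X ⟨0, Caputo.dim_pos α h0 hα hk⟩)) ∧
    (∀ x, Caputo.IsMultiTermSolution a b α f ξ x →
      (∀ j ≤ Caputo.dim α, Caputo.ContCaputoDiff a b ((j : ℝ) / Caputo.lcmDen α) x) ∧
      Caputo.IsReducedSolution a b α h0 hα f ξ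
        (fun j => Caputo.caputoDeriv a b ((j : ℝ) / Caputo.lcmDen α) x)) := by
  simp only [Caputo.isMultiTermSolution_iff hab h0 hα, Caputo.isReducedSolution_iff hab hf]
  obtain ⟨g, hg, huniq⟩ := Caputo.existsUnique_isTopDerivative h0 hα hf hK ξ
  refine ⟨⟨_, ⟨g, hg, fun _ _ => rfl⟩, ?_⟩, ⟨_, ⟨g, hg, fun _ _ _ => rfl⟩, ?_⟩, ?_, ?_⟩
  · rintro y ⟨g', hg', hy⟩
    exact hy.trans (Caputo.chainMember_congr _ _ _ _ _ (huniq g' hg'))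
  · rintro Y ⟨g', hg', hY⟩ j
    exact (hY j).trans (Caputo.chainMember_congr _ _ _ _ _ (huniq g' hg'))
  · rintro X ⟨g', hg', hX⟩
    exact ⟨g', hg', hX _⟩
  · rintro x ⟨g', hg', hx⟩
    have hprim := fun {j} => Caputo.isCaputoPrimitive_chainMember (j := j) hab
      (Caputo.lcmDen_pos α) hg'.continuousOn (hx := hx)
    exact ⟨fun j hj => (hprim hj).contDiff, g', hg', fun j => (hprim j.2.le).deriv_eqOn⟩

theorem corollary4p1 (a b : ℝ) (hab : a < b) (k : ℕ) (hk : 0 < k)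
    (α : Fin (k + 1) → ℚ) (h0 : α 0 = 0) (hα : StrictMono α)
    (hgap : ∀ i : Fin k, α i.succ - α i.castSucc ≤ 1)
    (f : ℝ → (Fin k → ℝ) → ℝ)
    (hf : ContinuousOn (Function.uncurry f) (Set.Icc a b ×ˢ Set.univ))
    (L : ℝ) (hL : 0 < L)
    (hLip : ∀ t ∈ Set.Icc a b, ∀ y z : Fin k → ℝ, |f t y - f t z| ≤ L * ‖y - z‖)
    (ξ : ℕ → ℝ) :
    -- the multi-term problem has a unique solution on `[a,b]`
    (∃ x, Caputo.IsMultiTermSolution a b α f ξ x ∧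
      ∀ y, Caputo.IsMultiTermSolution a b α f ξ y → Set.EqOn y x (Set.Icc a b)) ∧
    -- the reduced system has a unique solution on `[a,b]`
    (∃ X, Caputo.IsReducedSolution a b α h0 hα f ξ X ∧
      ∀ Y, Caputo.IsReducedSolution a b α h0 hα f ξ Y → ∀ j, Set.EqOn (Y j) (X j) (Set.Icc a b)) ∧
    -- the zeroth component of a solution of the system solves the multi-term problem
    (∀ X, Caputo.IsReducedSolution a b α h0 hα f ξ X →
      Caputo.IsMultiTermSolution a b α f ξ (X ⟨0, Caputo.dim_pos α h0 hα hk⟩)) ∧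
    -- the derivatives of order `j γ` of a solution of the multi-term problem exist and are
    -- continuous, and they solve the system
    (∀ x, Caputo.IsMultiTermSolution a b α f ξ x →
      (∀ j ≤ Caputo.dim α, Caputo.ContCaputoDiff a b ((j : ℝ) / Caputo.lcmDen α) x) ∧
      Caputo.IsReducedSolution a b α h0 hα f ξ
        (fun j => Caputo.caputoDeriv a b ((j : ℝ) / Caputo.lcmDen α) x)) :=
  corollary4p1_general a b hab k hk α h0 hα f hf ⟨L, hL.le⟩
    (fun t ht => .of_dist_le_mul fun y z => by
      rw [dist_eq_norm, dist_eq_norm, Real.norm_eq_abs]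
      exact hLip t ht y z) ξ
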